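/- A \emph{verifier} over an input alphabet $\Sigma$ is a probabilistic Turing machine $V$ with finitely many states, a two-way read-only input tape holding the input $w\in\Sigma^*$ between two end-markers, one read/write work tape (initially blank), and a communication cell. Its states are divided into reading states (among them the initial state), communicating states, an accepting and a rejecting halting state. In a reading state, depending on the state and the symbols under the two heads, $V$ chooses a new state, a symbol to write on the work tape and a move in $\{\leftarrow,\downarrow,\rightarrow\}$ of each head, according to a probability distribution with arbitrary real probabilities. In a communicating state $V$ writes a symbol, determined by the state, on the communication cell, the prover replies with a symbol, and $V$ enters a state determined by its current state and the reply. A \emph{prover} is an arbitrary function that gives each reply, depending only on the input and on the symbols that $V$ has sent so far (so it does not see the random choices of $V$). The space used by $V$ on $w$ with a given prover is the number of work tape cells that are visited with nonzero probability. \textbf{Theorem.} For every unary language $L\subseteq\{a\}^*$ there are a verifier $V$ over $\{a\}$ and an error bound $\epsilon$ with $0\le\epsilon<\frac12$ such that 1. (completeness) there is a prover $P$ such that, for every $w\in L$, $V$ communicating with $P$ accepts $w$ with probability at least $1-\epsilon$; 2. (soundness) for every $w\in\{a\}^*\setminus L$ and every prover $P^*$, $V$ communicating with $P^*$ rejects $w$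 with probability at least $1-\epsilon$; 3. (space) $V$ is $O(\log n)$ space bounded: there is a constant $K$ such that, on every input of length $n\ge 0$ and with every prover, $V$ uses at most $K(\lfloor\log_2 n\rfloor+1)$ work tape cells, where $\lfloor\log_2 n\rfloor$ is read as $0$ for $n=0$. -/

import Mathlib

open scoped ENNReal

/-- The symbols that can appear on the input tape: the two end-markers and the input letters. -/
inductive InputSymbol (A : Type) : Type
  | leftEnd : InputSymbol A
  | letter : A → InputSymbol A
  | rightEnd : InputSymbol A

/-- Head movements: one cell to the left, no move, one cell to the right. -/
inductive HeadMove : Type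
  | left : HeadMove
  | stay : HeadMove
  | right : HeadMove

/-- The states of a verifier: reading states `R`, communicating states `C`, and the two halting
states. -/
inductive VState (R C : Type) : Type
  | reading : R → VState R C
  | communicating : C → VState R C
  | accept : VState R C
  | reject : VState R C

/-- A probabilistic Turing machine verifier with input alphabet `A`: a two-way read-only input
tape, a read/write work tape and a communication cell. The work tape symbols are `Option Γ`, where
`none` is the blank. The transition probabilities are arbitrary real numbers in `[0,1]` that sum
to `1` (a `PMF` on a finite set). -/
structure PTMVerifier (A : Type) : Type 1 where
  /-- reading states -/
  R : Type
  /-- communicating states -/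
  C : Type
  /-- work tape alphabet, without the blank -/
  Γ : Type
  /-- communication alphabet -/
  Υ : Type
  finite_R : Finite R
  finite_C : Finite C
  finite_Γ : Finite Γ
  finite_Υ : Finite Υ
  nonempty_Υ : Nonempty Υ
  /-- the initial state, which is a reading state -/
  start : R
  /-- in a reading state, with the symbols under the two heads: the distribution of the new state,
  the symbol written on the work tape, the input head move and the work head move -/
  readStep : R → InputSymbol A → Option Γ →
    PMF (VState R C × Option Γ × HeadMove × HeadMove)
  /-- the symbol that is written on the communication cell in a communicating state -/
  send : C → Υ
  /-- the next state, depending on the communicating state and on the reply of the prover -/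
  commStep : C → Υ → VState R C

namespace PTMVerifier

variable {A : Type}

/-- The symbol at position `p` of the input tape holding `w` between its end-markers: position `0`
holds the left end-marker and position `w.length + 1` the right one. -/
def inputSymbolAt (w : List A) : ℕ → InputSymbol A
  | 0 => InputSymbol.leftEnd
  | p + 1 =>
    match w[p]? with
    | some a => InputSymbol.letter a
    | none => InputSymbol.rightEnd

/-- The move of the input head on an input of length `n`. The head stays on the tape segment
`0, …, n + 1`: a move beyond an end-marker leaves it where it is. -/
def moveInput (n : ℕ) : HeadMove → ℕ → ℕ
  | HeadMove.left, p => p - 1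
  | HeadMove.stay, p => p
  | HeadMove.right, p => min (p + 1) (n + 1)

/-- The move of the work head on its tape, which is infinite in both directions. -/
def moveWork : HeadMove → ℤ → ℤ
  | HeadMove.left, z => z - 1
  | HeadMove.stay, z => z
  | HeadMove.right, z => z + 1

/-- A prover for `V`: a strategy (of unlimited power) that replies with a symbol, given only the
input and the symbols that the verifier has written on the communication cell so far (the most
recent one first). -/
def Prover (V : PTMVerifier A) : Type :=
  List A → List V.Υ → V.Υ

/-- A configuration: state, input head position, work tape, work head position and the list of
symbols that the verifier has sent so far (the most recent one first). The last component is what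
the prover sees; it is not part of the memory of the verifier. -/
structure Config (V : PTMVerifier A) : Type where
  state : VState V.R V.C
  inputPos : ℕ
  work : ℤ → Option V.Γ
  workPos : ℤ
  sent : List V.Υ

/-- The initial configuration: both heads on their initial cells, blank work tape. -/
def initialConfig (V : PTMVerifier A) : V.Config where
  state := VState.reading V.start
  inputPos := 0
  work := fun _ => none
  workPos := 0
  sent := []

/-- One step of `V` on input `w` with prover `P`. Halting configurations do not change. -/
noncomputable def step (V : PTMVerifier A) (w : List A) (P : V.Prover) (c : V.Config) :
    PMF V.Config :=
  match c.state with
  | VState.reading s =>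
    (V.readStep s (inputSymbolAt w c.inputPos) (c.work c.workPos)).map fun o =>
      { state := o.1
        inputPos := moveInput w.length o.2.2.1 c.inputPos
        work := Function.update c.work c.workPos o.2.1
        workPos := moveWork o.2.2.2 c.workPos
        sent := c.sent }
  | VState.communicating s =>
    PMF.pure
      { state := V.commStep s (P w (V.send s :: c.sent))
        inputPos := c.inputPos
        work := c.work
        workPos := c.workPos
        sent := V.send s :: c.sent }
  | VState.accept => PMF.pure c
  | VState.reject => PMF.pure c

/-- The distribution of the configuration after `t` steps. -/
noncomputable def run (V : PTMVerifier A) (w : List A) (P : V.Prover) : ℕ → PMF V.Config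
  | 0 => PMF.pure V.initialConfig
  | t + 1 => (V.run w P t).bind (V.step w P)

/-- The probability that `V`, communicating with `P`, eventually accepts `w`. The probability of
having accepted within `t` steps is nondecreasing in `t`. -/
noncomputable def acceptProb (V : PTMVerifier A) (w : List A) (P : V.Prover) : ℝ≥0∞ :=
  ⨆ t : ℕ, (V.run w P t).toOuterMeasure {c | c.state = VState.accept}

/-- The probability that `V`, communicating with `P`, eventually rejects `w`. -/
noncomputable def rejectProb (V : PTMVerifier A) (w : List A) (P : V.Prover) : ℝ≥0∞ :=
  ⨆ t : ℕ, (V.run w P t).toOuterMeasure {c | c.state = VState.reject}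

/-- The work tape cells that are visited with nonzero probability on input `w` with prover `P`. -/
def visitedCells (V : PTMVerifier A) (w : List A) (P : V.Prover) : Set ℤ :=
  {z | ∃ t : ℕ, ∃ c ∈ (V.run w P t).support, c.workPos = z}

/-- `V` is `O(s(n))` space bounded: on every input of length `n ≥ 0` and with every prover, it
visits at most `K * (s n + 1)` work tape cells, for a constant `K`. -/
def SpaceBounded (V : PTMVerifier A) (s : ℕ → ℕ) : Prop :=
  ∃ K : ℕ, ∀ (w : List A) (P : V.Prover),
    (V.visitedCells w P).encard ≤ ((K * (s w.length + 1) : ℕ) : ℕ∞)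

/-- `V` verifies the language `L` with error bound `ε`: with some honest prover every member is
accepted with probability at least `1 - ε`, and with any prover every nonmember is rejected with
probability at least `1 - ε`. -/
def Verifies (V : PTMVerifier A) (L : Language A) (ε : ℝ) : Prop :=
  (∃ P : V.Prover, ∀ w ∈ L, ENNReal.ofReal (1 - ε) ≤ V.acceptProb w P) ∧
    ∀ w ∉ L, ∀ P : V.Prover, ENNReal.ofReal (1 - ε) ≤ V.rejectProb w P

end PTMVerifier

/-!
# Interactive proofs for unary languages

The language is encoded in the base `8` digits of a real number `θ`. The verifier works in rounds
and never moves its work head. In a round the prover sends rows of `2 * (n + 1)` symbols, which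
describe the carries of a base `8` counter with `n + 1` digits, so that there are `8 ^ (n + 1)`
rows, and marks some of the rows. The verifier privately chooses either one digit of the counter,
which it then checks, or a comparison of the number of marked rows with `θ * 8 ^ (n + 1)`; the
parity of the number of marked rows tells whether the input is in the language. In each row the
verifier may also start a new round, which makes it accept much less often than it rejects a wrong
counter.
-/

/-! ### Expectations with respect to a `PMF` -/

namespace PMF

variable {α β : Type*}

/-! Membership of all words is stored in one real probability parameter `θ`. With `N = 8 ^ (n + 1)`,
the integer part `M` of `θ * N` is odd exactly for members, and its distance to `θ * N` is at most
`1 / 4`. The prover marks `m` of `N` rows, and the verifier has to check that there are `N` rows and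
that `m` is near `θ * N`. The input head serves as the clock: a trip between the end-markers and
back takes `2 * (n + 1)` moves, the length of a row. One work cell is therefore enough.

Every request within a round looks alike, so the prover commits to a single stream before knowing
which test is run. A column test watches two adjacent columns through the head's phase and survives
a row with probability `1 / 2`. A comparison survives a row with probability `1 / 512`, times `256 ^
(y - θ)` or `256 ^ (θ - y)` (with `y` equal to `0` or `1`) in modes `low` and `high`. Over `N` rows
the weights of `acc`, `low` and `high` are `512 ^ (-N)` times `1`, `256 ^ (m - θ * N)` and `256 ^ (θ
* N - m)`; only `acc` with odd `m` accepts. If `m = M` is odd, acceptance weighs `7 / 8` against at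
most `(1 + 4) / 16` for rejection. If `m` is odd and `M` even, then `|m - θ * N| ≥ 3 / 4` and
rejection weighs at least `64 / 16`. A counter that first goes wrong in row `I` is caught with
weight of order `2 ^ (-I)`, or by `acc` itself in column `0`, while acceptance has weight at most of
order `512 ^ (-I)`.

Rounds without a verdict restart, possibly forever. Instead of proving termination, let `ρ ≤ 7 / 10`
bound from below the probability of the right verdict at every start of a round.
`completeness_bound` and `soundness_bound` improve it by `δ * (7 / 10 - ρ)`, with `δ > 0` depending
only on `n`. Hence the infimum is at least `7 / 10` (`le_of_forall_improve`). -/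

/-- The expectation of a nonnegative function. -/
noncomputable def expect (μ : PMF α) (f : α → ℝ≥0∞) : ℝ≥0∞ := ∑' x, μ x * f x

theorem expect_pure (a : α) (f : α → ℝ≥0∞) : (PMF.pure a).expect f = f a := by
  rw [expect, tsum_eq_single a]
  · simp
  · intro b hb
    simp [PMF.pure_apply, hb]

theorem expect_bind (μ : PMF α) (κ : α → PMF β) (f : β → ℝ≥0∞) :
    (μ.bind κ).expect f = μ.expect fun a => (κ a).expect f := by
  simp only [expect, PMF.bind_apply, ← ENNReal.tsum_mul_right, ← ENNReal.tsum_mul_left]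
  rw [ENNReal.tsum_comm]
  simp only [mul_assoc]

theorem expect_map (μ : PMF α) (g : α → β) (f : β → ℝ≥0∞) :
    (μ.map g).expect f = μ.expect (f ∘ g) := by
  rw [← PMF.bind_pure_comp, expect_bind]
  simp only [Function.comp_apply, expect_pure]
  rfl

theorem expect_mono (μ : PMF α) {f g : α → ℝ≥0∞} (h : ∀ a, f a ≤ g a) :
    μ.expect f ≤ μ.expect g :=
  ENNReal.tsum_le_tsum fun a => mul_le_mul_right (h a) _

theorem expect_one (μ : PMF α) : (μ.expect fun _ => 1) = 1 := by
  simp [expect, μ.tsum_coe]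

theorem expect_iSup_le (μ : PMF α) {f : ℕ → α → ℝ≥0∞} (hf : Monotone f) :
    (μ.expect fun a => ⨆ t, f t a) ≤ ⨆ t, μ.expect (f t) := by
  refine ENNReal.summable.tsum_le_of_sum_le fun s => ?_
  have : ∀ a, μ a * ⨆ t, f t a = ⨆ t, μ a * f t a := fun a => ENNReal.mul_iSup ..
  simp only [this]
  rw [ENNReal.finsetSum_iSup_of_monotone (f := fun a t => μ a * f t a) fun a i j hij => mul_le_mul_right (hf hij a) _]
  exact iSup_mono fun t => ENNReal.sum_le_tsum s

open Classical in
theorem toOuterMeasure_eq_expect (μ : PMF α) (s : Set α) :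
    μ.toOuterMeasure s = μ.expect fun a => if a ∈ s then 1 else 0 := by
  rw [toOuterMeasure_apply, expect]
  refine tsum_congr fun a => ?_
  by_cases h : a ∈ s <;> simp [h]

/-- The distribution that gives `x` with probability `p` and `y` with probability `1 - p`. -/
noncomputable def coin (p : unitInterval) (x y : α) : PMF α :=
  (PMF.ofFintype (fun b : Bool => cond b (ENNReal.ofReal p) (ENNReal.ofReal (1 - p))) (by
    simp only [Fintype.univ_bool, Finset.mem_singleton, Bool.true_eq_false, not_false_eq_true,
      Finset.sum_insert, cond_true, Finset.sum_singleton, cond_false]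
    rw [← ENNReal.ofReal_add p.2.1 (by linarith [p.2.2])]
    simp)).map fun b => cond b x y

theorem expect_coin (p : unitInterval) (x y : α) (f : α → ℝ≥0∞) :
    (coin p x y).expect f = ENNReal.ofReal p * f x + ENNReal.ofReal (1 - p) * f y := by
  rw [coin, expect_map, expect, tsum_fintype]
  simp

end PMF

/-! ### Halting probabilities as functions of the configuration -/

namespace PTMVerifier

variable {A : Type} (V : PTMVerifier A) (w : List A) (P : V.Prover)

open Classical in
/-- The probability of being in state `q` after `t` steps from a configuration. -/
noncomputable def hitProb (q : VState V.R V.C) : ℕ → V.Config → ℝ≥0∞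
  | 0, c => if c.state = q then 1 else 0
  | t + 1, c => (V.step w P c).expect (hitProb q t)

/-- The probability of eventually being in the halting state `q`. -/
noncomputable def value (q : VState V.R V.C) (c : V.Config) : ℝ≥0∞ :=
  ⨆ t, V.hitProb w P q t c

variable {V w P} {q : VState V.R V.C}

/-- `run` adds steps at the end and `hitProb` at the beginning; this identity passes between the
two. -/
theorem expect_run_hitProb (s t : ℕ) :
    (V.run w P s).expect (V.hitProb w P q t) = V.hitProb w P q (s + t) V.initialConfig := by
  induction s generalizing t with
  | zero => rw [run, PMF.expect_pure, zero_add]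
  | succ s ih =>
    rw [run, PMF.expect_bind, show s + 1 + t = s + (t + 1) by ring, ← ih]
    rfl

theorem toOuterMeasure_run (t : ℕ) :
    (V.run w P t).toOuterMeasure {c | c.state = q} = V.hitProb w P q t V.initialConfig := by
  rw [PMF.toOuterMeasure_eq_expect, ← add_zero t, ← expect_run_hitProb, add_zero]
  rfl

theorem acceptProb_eq_value :
    V.acceptProb w P = V.value w P VState.accept V.initialConfig :=
  iSup_congr fun t => toOuterMeasure_run t

theorem rejectProb_eq_value :
    V.rejectProb w P = V.value w P VState.reject V.initialConfig :=
  iSup_congr fun t => toOuterMeasure_run t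

theorem hitProb_le_one (t : ℕ) (c : V.Config) : V.hitProb w P q t c ≤ 1 := by
  induction t generalizing c with
  | zero =>
    rw [hitProb]
    split_ifs <;> simp
  | succ t ih => exact (PMF.expect_mono _ ih).trans (PMF.expect_one _).le

theorem value_le_one (c : V.Config) : V.value w P q c ≤ 1 :=
  iSup_le fun t => hitProb_le_one t c

theorem step_of_halted (hq : q = VState.accept ∨ q = VState.reject) {c : V.Config}
    (hc : c.state = q) : V.step w P c = PMF.pure c := by
  unfold step
  rcases hq with rfl | rfl <;> rw [hc]

theorem hitProb_of_halted (hq : q = VState.accept ∨ q = VState.reject) {c : V.Config}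
    (hc : c.state = q) (t : ℕ) : V.hitProb w P q t c = 1 := by
  induction t with
  | zero => simp [hitProb, hc]
  | succ t ih => rw [hitProb, step_of_halted hq hc, PMF.expect_pure, ih]

theorem value_of_halted (hq : q = VState.accept ∨ q = VState.reject) {c : V.Config}
    (hc : c.state = q) : V.value w P q c = 1 := by
  simp [value, hitProb_of_halted hq hc]

theorem hitProb_mono (hq : q = VState.accept ∨ q = VState.reject) :
    Monotone (V.hitProb w P q) := by
  refine monotone_nat_of_le_succ fun t => ?_
  induction t with
  | zero =>
    intro c
    by_cases hc : c.state = q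
    · rw [hitProb_of_halted hq hc, hitProb_of_halted hq hc]
    · simp [hitProb, hc]
  | succ t ih => exact fun c => PMF.expect_mono _ ih

/-- The value function is superharmonic. -/
theorem expect_step_value_le (hq : q = VState.accept ∨ q = VState.reject) (c : V.Config) :
    (V.step w P c).expect (V.value w P q) ≤ V.value w P q c :=
  (PMF.expect_iSup_le _ (hitProb_mono hq)).trans
    (iSup_le fun t => le_iSup (fun t => V.hitProb w P q t c) (t + 1))

end PTMVerifier

/-! ### Encoding a set of natural numbers in the digits of a real number -/

/-- Base `8` digits `0` and `1` of a real number in `[0, 1]` encode a set of natural numbers: the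
membership of `n` is the parity of the integer part of the number times `8 ^ (n + 1)`, and the
fractional part is at most `1 / 4`. -/
theorem exists_real_encoding (b : ℕ → Prop) :
    ∃ θ : ℝ, 0 ≤ θ ∧ θ ≤ 1 ∧ ∀ n, ∃ M : ℕ, M ≤ 8 ^ (n + 1) ∧ (Odd M ↔ b n) ∧
      (M : ℝ) ≤ θ * 8 ^ (n + 1) ∧ θ * 8 ^ (n + 1) ≤ M + 1 / 4 := by
  classical
  let d : ℕ → Fin 8 := fun i => if b i then 1 else 0
  have hd : ∀ i, (d i : ℕ) = if b i then 1 else 0 := fun i => by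
    by_cases h : b i <;> simp [d, h]
  have hsum : ∀ n, ∃ M : ℕ, (Odd M ↔ b n) ∧
      (M : ℝ) = 8 ^ (n + 1) * ∑ i ∈ Finset.range (n + 1), Real.ofDigitsTerm d i := by
    -- The base is even, so the parity is that of the last digit.
    have hodd : ∀ n M : ℕ, Odd (8 * M + (d n : ℕ)) ↔ b n := by
      intro n M
      rw [hd]
      split_ifs with h
      · simp [h, Nat.odd_iff]; omega
      · simp [h, Nat.odd_iff]; omega
    intro n
    induction n with
    | zero =>
      refine ⟨8 * 0 + d 0, hodd 0 0, ?_⟩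
      simp [Real.ofDigitsTerm]
      ring
    | succ n ih =>
      obtain ⟨M, -, hM⟩ := ih
      refine ⟨8 * M + d (n + 1), hodd _ M, ?_⟩
      rw [Finset.sum_range_succ, mul_add, pow_succ (8 : ℝ) (n + 1), mul_right_comm, ← hM,
        Real.ofDigitsTerm]
      push_cast
      field_simp
      ring
  -- The first digit contributes at most `1 / 8`, and all later ones together at most `1 / 8`.
  have htail : ∀ a : ℕ → Fin 8, (∀ i, (a i : ℕ) ≤ 1) → Real.ofDigits a ≤ 1 / 4 := by
    intro a ha
    rw [Real.ofDigits_eq_sum_add_ofDigits a 1]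
    have h1 := Real.ofDigits_le_one fun i => a (i + 1)
    have h0 : (((a 0 : ℕ) : ℝ)) ≤ 1 := by exact_mod_cast ha 0
    simp [Real.ofDigitsTerm]
    linarith
  have hd1 : ∀ i, (d i : ℕ) ≤ 1 := fun i => by rw [hd]; split_ifs <;> simp
  refine ⟨Real.ofDigits d, Real.ofDigits_nonneg d, Real.ofDigits_le_one d, fun n => ?_⟩
  obtain ⟨M, hM, hMs⟩ := hsum n
  have hsplit : Real.ofDigits d * 8 ^ (n + 1) =
      M + Real.ofDigits (fun i => d (i + (n + 1))) := by
    rw [Real.ofDigits_eq_sum_add_ofDigits d (n + 1), hMs]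
    push_cast
    field_simp
  have h0 := Real.ofDigits_nonneg (fun i => d (i + (n + 1)))
  have h1 := htail (fun i => d (i + (n + 1))) fun i => hd1 _
  refine ⟨M, ?_, hM, by linarith, by linarith⟩
  have h8 : (M : ℝ) ≤ 8 ^ (n + 1) := by
    have := mul_le_of_le_one_left (a := Real.ofDigits d) (b := (8 : ℝ) ^ (n + 1)) (by positivity)
      (Real.ofDigits_le_one d)
    linarith
  exact_mod_cast h8

/-! ### Streams that describe the carries of a base `8` counter -/

/-- The number modulo `8` of rows before row `i` in which the entry of column `k` is set. -/
def columnCount (e : ℕ → ℕ → Bool) (k : ℕ) : ℕ → ZMod 8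
  | 0 => 0
  | i + 1 => if e i k then columnCount e k i + 1 else columnCount e k i

/-- The entry of column `k + 1` in row `i` is the carry out of the digit counted by column `k`. -/
def IsCarry (e : ℕ → ℕ → Bool) (k i : ℕ) : Prop :=
  e i (k + 1) = (e i k && decide (columnCount e k i = 7))

/-- Among `1, …, i` there are `i / 8 ^ k` multiples of `8 ^ k`; modulo `8` this is digit `k` of the
counter. -/
theorem columnCount_of_dvd {e : ℕ → ℕ → Bool} {k I : ℕ}
    (h : ∀ i < I, e i k = decide (8 ^ k ∣ i + 1)) :
    ∀ i ≤ I, columnCount e k i = ((i / 8 ^ k : ℕ) : ZMod 8) := by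
  intro i hi
  induction i with
  | zero => simp [columnCount]
  | succ i ih =>
    rw [columnCount, h i (by omega), ih (by omega), Nat.succ_div]
    by_cases hd : 8 ^ k ∣ i + 1 <;> simp [hd]

/-- If `8 ^ k ∣ i + 1`, the quotient is `i / 8 ^ k + 1`, so a further factor `8` means that digit
`k` was `7`. -/
theorem eight_pow_succ_dvd_iff (k i : ℕ) :
    8 ^ (k + 1) ∣ i + 1 ↔ 8 ^ k ∣ i + 1 ∧ ((i / 8 ^ k : ℕ) : ZMod 8) = 7 := by
  have hpos : 0 < 8 ^ k := by positivity
  have h7 : ((i / 8 ^ k : ℕ) : ZMod 8) = 7 ↔ (i / 8 ^ k) % 8 = 7 := by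
    rw [show (7 : ZMod 8) = ((7 : ℕ) : ZMod 8) by rfl, ZMod.natCast_eq_natCast_iff']
  rw [h7]
  constructor
  · intro h
    have h1 : 8 ^ k ∣ i + 1 := (pow_dvd_pow 8 (Nat.le_succ k)).trans h
    refine ⟨h1, ?_⟩
    have h2 := Nat.succ_div (a := i) (b := 8 ^ k)
    rw [if_pos h1] at h2
    have h3 : 8 ∣ (i + 1) / 8 ^ k := by
      rw [pow_succ] at h
      exact Nat.dvd_div_of_mul_dvd h
    omega
  · rintro ⟨h1, h2⟩
    have h3 := Nat.succ_div (a := i) (b := 8 ^ k)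
    rw [if_pos h1] at h3
    have h4 : 8 ∣ (i + 1) / 8 ^ k := by omega
    rw [pow_succ]
    exact Nat.mul_dvd_of_dvd_div h1 h4

theorem isCarry_of_dvd {e : ℕ → ℕ → Bool} {n : ℕ}
    (h : ∀ i, ∀ k ≤ n + 1, e i k = decide (8 ^ k ∣ i + 1)) {k : ℕ} (hk : k ≤ n) (i : ℕ) :
    IsCarry e k i := by
  rw [IsCarry, h i _ (by omega), h i _ (by omega),
    columnCount_of_dvd (I := i) (fun j _ => h j k (by omega)) i le_rfl, ← Bool.decide_and]
  exact decide_eq_decide.2 (eight_pow_succ_dvd_iff k i)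

/-- Induction on the column: a correct column determines its digit, and the carry rule then gives
the next column. Only rows below `I` enter, since a cheating prover may deviate later. -/
theorem dvd_of_isCarry {e : ℕ → ℕ → Bool} {I n : ℕ} (h0 : ∀ i < I, e i 0 = true)
    (hc : ∀ i < I, ∀ k ≤ n, IsCarry e k i) :
    ∀ k ≤ n + 1, ∀ i < I, e i k = decide (8 ^ k ∣ i + 1) := by
  intro k hk
  induction k with
  | zero => simpa using h0
  | succ k ih =>
    intro i hi
    have ih := ih (by omega)
    have := hc i hi k (by omega)
    rw [this, ih i hi, columnCount_of_dvd ih i hi.le, ← Bool.decide_and]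
    exact decide_eq_decide.2 (eight_pow_succ_dvd_iff k i).symm

/-! ### The verifier -/

namespace UnaryVerifier

/-- The three ways of comparing the number of rows with the number of marked rows. -/
inductive Mode : Type
  | acc : Mode
  | low : Mode
  | high : Mode

/-- The reading states. The direction `true` is to the right. -/
inductive ReadState : Type
  | home : ReadState
  | choose : ReadState
  | pick : ReadState
  | main (a : Mode) (dir parity entry mark : Bool) : ReadState
  | check (dir : Bool) (count : ZMod 8) (prev entry : Bool) : ReadState

/-- The communicating states. -/
inductive CommState : Type
  | restart : CommState
  | main (a : Mode) (dir parity : Bool) : CommState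
  | check (dir : Bool) (count : ZMod 8) (prev : Bool) : CommState

instance : Finite Mode :=
  Finite.of_injective
    (fun | .acc => (0 : Fin 3) | .low => 1 | .high => 2 : Mode → Fin 3)
    (by rintro (_ | _ | _) (_ | _ | _) h <;> first | rfl | simp at h)

instance : Finite ReadState :=
  Finite.of_injective
    (fun
      | .home => Sum.inl 0
      | .choose => Sum.inl 1
      | .pick => Sum.inl 2
      | .main a d p e y => Sum.inr (Sum.inl (a, d, p, e, y))
      | .check d c u e => Sum.inr (Sum.inr (d, c, u, e)) :
      ReadState → Fin 3 ⊕ (Mode × Bool × Bool × Bool × Bool) ⊕ (Bool × ZMod 8 × Bool × Bool))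
    (by
      rintro (_ | _ | _ | ⟨a, d, p, e, y⟩ | ⟨d, c, u, e⟩) (_ | _ | _ | ⟨a, d, p, e, y⟩ | ⟨d, c, u, e⟩) h
        <;> simp_all)

instance : Finite CommState :=
  Finite.of_injective
    (fun
      | .restart => Sum.inl ()
      | .main a d p => Sum.inr (Sum.inl (a, d, p))
      | .check d c u => Sum.inr (Sum.inr (d, c, u)) :
      CommState → Unit ⊕ (Mode × Bool × Bool) ⊕ (Bool × ZMod 8 × Bool))
    (by
      rintro (_ | ⟨a, d, p⟩ | ⟨d, c, u⟩) (_ | ⟨a, d, p⟩ | ⟨d, c, u⟩) h <;> simp_all)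

/-- The probability of surviving a row, depending on whether the row is marked. -/
noncomputable def weight (θ : ℝ) : Mode → Bool → ℝ
  | .acc, _ => 1 / 512
  | .low, y => (256 : ℝ) ^ ((if y then 1 else 0) - θ) / 512
  | .high, y => (256 : ℝ) ^ (θ - (if y then 1 else 0)) / 512

theorem weight_pos (θ : ℝ) (a : Mode) (y : Bool) : 0 < weight θ a y := by
  cases a <;> simp only [weight] <;> positivity

/-- The exponents are at most `1` and `256 / 512 = 1 / 2`. This makes the weights probabilities, and
halving per row makes endless rounds negligible. -/
theorem weight_le_half {θ : ℝ} (h0 : 0 ≤ θ) (h1 : θ ≤ 1) (a : Mode) (y : Bool) :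
    weight θ a y ≤ 1 / 2 := by
  have key : ∀ x : ℝ, x ≤ 1 → (256 : ℝ) ^ x / 512 ≤ 1 / 2 := fun x hx => by
    have := Real.rpow_le_rpow_of_exponent_le (x := 256) (by norm_num) hx
    rw [Real.rpow_one] at this
    linarith
  cases a
  · norm_num [weight]
  · exact key _ (by split_ifs <;> linarith)
  · exact key _ (by split_ifs <;> linarith)

/-- The states of the verifier. -/
abbrev State : Type := VState ReadState CommState

/-- A transition: the probability of the first outcome, and the two outcomes, each a new state and
a move of the input head. -/
abbrev Transition : Type := unitInterval × (State × HeadMove) × (State × HeadMove)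

/-- A deterministic transition. -/
def Transition.always (s : State) (m : HeadMove) : Transition := (1, (s, m), (s, m))

/-- A head move in a given direction. -/
def dirMove (dir : Bool) : HeadMove := if dir then HeadMove.right else HeadMove.left

/-- The transition in a reading state. -/
noncomputable def action (θ : ℝ) : ReadState → InputSymbol Unit → Transition
  | .home, .leftEnd => .always (.reading .choose) .stay
  | .home, _ => .always (.reading .home) .left
  | .choose, .rightEnd =>
    (⟨7 / 8, by norm_num, by norm_num⟩,
      (.communicating (.main .acc true false), .stay), (.reading .pick, .stay))
  | .choose, _ =>
    (⟨1 / 2, by norm_num, by norm_num⟩,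
      (.communicating (.check true 0 false), .stay), (.reading .choose, .right))
  | .pick, _ =>
    (⟨1 / 2, by norm_num, by norm_num⟩,
      (.communicating (.main .low true false), .stay),
      (.communicating (.main .high true false), .stay))
  | .main a _ p e y, .rightEnd =>
    if e then
      -- The clamp only makes the definition total in `θ`; it has no effect for `θ` in `[0, 1]`.
      (Set.projIcc 0 1 zero_le_one (weight θ a y),
        (.communicating (.main a false (xor p y)), .left), (.communicating .restart, .stay))
    else .always .reject .stay
  | .main a _ p e _, .leftEnd =>
    if e then
      match a, p with
      | .acc, true => .always .accept .stay
      | _, _ => .always .reject .stay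
    else .always (.communicating (.main a true p)) .right
  | .main a d p _ _, .letter _ => .always (.communicating (.main a d p)) (dirMove d)
  | .check _ c u e, .rightEnd =>
    if e = (u && decide (c = 7)) then
      (⟨1 / 2, by norm_num, by norm_num⟩,
        (.communicating (.check false (if u then c + 1 else c) e), .left),
        (.communicating .restart, .stay))
    else .always .reject .stay
  | .check _ c _ e, .leftEnd => .always (.communicating (.check true c e)) .right
  | .check d c _ e, .letter _ => .always (.communicating (.check d c e)) (dirMove d)

/-- The symbol sent to ask for the next symbol of the stream. -/
def cont : Bool × Bool := (false, false)

/-- The symbol sent to announce a new round. -/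
def fresh : Bool × Bool := (true, false)

/-- The verifier with the real parameter `θ`. Its work head never moves. -/
noncomputable def verifier (θ : ℝ) : PTMVerifier Unit where
  R := ReadState
  C := CommState
  Γ := Empty
  Υ := Bool × Bool
  finite_R := inferInstance
  finite_C := inferInstance
  finite_Γ := inferInstance
  finite_Υ := inferInstance
  nonempty_Υ := inferInstance
  start := .home
  readStep s x _ :=
    (PMF.coin (action θ s x).1 (action θ s x).2.1 (action θ s x).2.2).map
      fun o => (o.1, none, o.2, HeadMove.stay)
  send
    | .restart => fresh
    | _ => cont
  commStep c r :=
    match c with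
    | .restart => .reading .home
    | .main a d p => .reading (.main a d p r.1 r.2)
    | .check d k u => .reading (.check d k u r.1)

open PTMVerifier

theorem visitedCells_subset (θ : ℝ) (w : List Unit) (P : (verifier θ).Prover) :
    (verifier θ).visitedCells w P ⊆ {0} := by
  rintro z ⟨t, c, hc, rfl⟩
  rw [Set.mem_singleton_iff]
  induction t generalizing c with
  | zero =>
    rw [run, PMF.support_pure, Set.mem_singleton_iff] at hc
    subst hc
    rfl
  | succ t ih =>
    rw [run, PMF.mem_support_bind_iff] at hc
    obtain ⟨c', hc', h⟩ := hc
    have h0 := ih c' hc'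
    unfold step at h
    split at h
    · rw [PMF.mem_support_map_iff] at h
      obtain ⟨o, ho, rfl⟩ := h
      obtain ⟨o', -, rfl⟩ := (PMF.mem_support_map_iff _ _ _).1 ho
      exact h0
    all_goals
      rw [PMF.support_pure, Set.mem_singleton_iff] at h
      subst h
      exact h0

theorem spaceBounded (θ : ℝ) (s : ℕ → ℕ) : (verifier θ).SpaceBounded s := by
  refine ⟨1, fun w P => ?_⟩
  refine (Set.encard_le_encard (visitedCells_subset θ w P)).trans ?_
  rw [Set.encard_singleton]
  exact_mod_cast (by omega : 1 ≤ 1 * (s w.length + 1))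

/-- The configuration with a given state, input head position and list of sent symbols. -/
def config (θ : ℝ) (s : State) (p : ℕ) (h : List (Bool × Bool)) : (verifier θ).Config where
  state := s
  inputPos := p
  work := fun _ => none
  workPos := 0
  sent := h

/-- The probability of eventually reaching a halting state, as a real number. -/
noncomputable def val (θ : ℝ) (w : List Unit) (P : (verifier θ).Prover) (q s : State) (p : ℕ)
    (h : List (Bool × Bool)) : ℝ :=
  ((verifier θ).value w P q (config θ s p h)).toReal

section Value

variable {θ : ℝ} {w : List Unit} {P : (verifier θ).Prover} {q : State}

theorem val_nonneg (s : State) (p : ℕ) (h : List (Bool × Bool)) : 0 ≤ val θ w P q s p h :=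
  ENNReal.toReal_nonneg

theorem value_ne_top (c : (verifier θ).Config) : (verifier θ).value w P q c ≠ ∞ :=
  ne_top_of_le_ne_top ENNReal.one_ne_top (value_le_one c)

theorem val_halted (hq : q = VState.accept ∨ q = VState.reject) (p : ℕ)
    (h : List (Bool × Bool)) : val θ w P q q p h = 1 := by
  rw [val, value_of_halted (V := verifier θ) hq rfl, ENNReal.toReal_one]

/-- Superharmonicity gives one inequality, which suffices because both verification conditions are
lower bounds. Real values allow the later subtraction of `ρ`. -/
theorem val_reading (hq : q = VState.accept ∨ q = VState.reject) (s : ReadState) (p : ℕ)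
    (h : List (Bool × Bool)) {π : unitInterval} {o₁ o₂ : State × HeadMove}
    (ha : action θ s (inputSymbolAt w p) = (π, o₁, o₂)) :
    π * val θ w P q o₁.1 (moveInput w.length o₁.2 p) h +
      (1 - π) * val θ w P q o₂.1 (moveInput w.length o₂.2 p) h ≤
      val θ w P q (.reading s) p h := by
  have hstep : (verifier θ).step w P (config θ (.reading s) p h) =
      (PMF.coin π o₁ o₂).map fun o => config θ o.1 (moveInput w.length o.2 p) h := by
    unfold step
    simp only [config, verifier, ha, PMF.map_comp]
    congr 1
    funext o
    simp only [Function.comp_apply, moveWork, Function.update_eq_self]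
  have hle := expect_step_value_le (V := verifier θ) (w := w) (P := P) (q := q) hq
    (config θ (.reading s) p h)
  rw [hstep, PMF.expect_map, PMF.expect_coin] at hle
  have := ENNReal.toReal_mono (value_ne_top _) hle
  simp only [Function.comp_apply] at this
  rw [ENNReal.toReal_add (ENNReal.mul_ne_top ENNReal.ofReal_ne_top (value_ne_top _))
    (ENNReal.mul_ne_top ENNReal.ofReal_ne_top (value_ne_top _)), ENNReal.toReal_mul,
    ENNReal.toReal_mul, ENNReal.toReal_ofReal π.2.1,
    ENNReal.toReal_ofReal (sub_nonneg.2 π.2.2)] at this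
  exact this

theorem val_reading_always (hq : q = VState.accept ∨ q = VState.reject) {s : ReadState} {p : ℕ}
    {s' : State} {m : HeadMove} (ha : action θ s (inputSymbolAt w p) = .always s' m)
    (h : List (Bool × Bool)) :
    val θ w P q s' (moveInput w.length m p) h ≤ val θ w P q (.reading s) p h := by
  have := val_reading (P := P) hq s p h ha
  simpa using this

theorem val_communicating (hq : q = VState.accept ∨ q = VState.reject) (s : CommState) (p : ℕ)
    (h : List (Bool × Bool)) :
    val θ w P q ((verifier θ).commStep s (P w ((verifier θ).send s :: h))) p
      ((verifier θ).send s :: h) ≤ val θ w P q (.communicating s) p h := by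
  have hle := expect_step_value_le (V := verifier θ) (w := w) (P := P) (q := q) hq
    (config θ (.communicating s) p h)
  have hstep : (verifier θ).step w P (config θ (.communicating s) p h) =
      PMF.pure (config θ ((verifier θ).commStep s (P w ((verifier θ).send s :: h))) p
        ((verifier θ).send s :: h)) := rfl
  rw [hstep, PMF.expect_pure] at hle
  exact ENNReal.toReal_mono (value_ne_top _) hle

end Value

end UnaryVerifier

/-! ### The value of a round -/

namespace UnaryVerifier

open PTMVerifier

theorem inputSymbolAt_zero (w : List Unit) : inputSymbolAt w 0 = InputSymbol.leftEnd := rfl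

theorem inputSymbolAt_letter {w : List Unit} {p : ℕ} (h0 : p ≠ 0) (hp : p ≤ w.length) :
    inputSymbolAt w p = InputSymbol.letter () := by
  obtain ⟨p, rfl⟩ := Nat.exists_eq_succ_of_ne_zero h0
  simp [inputSymbolAt, List.getElem?_eq_getElem (show p < w.length by omega)]

theorem inputSymbolAt_end (w : List Unit) :
    inputSymbolAt w (w.length + 1) = InputSymbol.rightEnd := by
  simp [inputSymbolAt]

theorem moveInput_right {n p : ℕ} (hp : p ≤ n) : moveInput n .right p = p + 1 := by
  simp only [moveInput]; omega

/-! ### Head trips between the end-markers during a round -/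

section Round

variable {θ : ℝ} {w : List Unit} {P : (verifier θ).Prover} {q : State}

theorem val_home (hq : q = VState.accept ∨ q = VState.reject) (p : ℕ) (h : List (Bool × Bool)) :
    val θ w P q (.reading .choose) 0 h ≤ val θ w P q (.reading .home) p h := by
  induction p with
  | zero => exact val_reading_always (p := 0) (m := .stay) hq rfl h
  | succ p ih =>
    refine ih.trans (val_reading_always (p := p + 1) (m := .left) hq ?_ h)
    by_cases hp : p + 1 ≤ w.length
    · rw [inputSymbolAt_letter (by omega) hp]; rfl
    · simp only [inputSymbolAt, List.getElem?_eq_none (show w.length ≤ p by omega)]; rfl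

theorem val_restart (hq : q = VState.accept ∨ q = VState.reject) (p : ℕ)
    (h : List (Bool × Bool)) :
    val θ w P q (.reading .choose) 0 (fresh :: h) ≤
      val θ w P q (.communicating .restart) p h :=
  (val_home hq p _).trans (val_communicating hq .restart p h)

/-- What has been sent after `t` requests in a round. -/
def sentAt (h : List (Bool × Bool)) (t : ℕ) : List (Bool × Bool) := List.replicate t cont ++ h

/-- The symbols that the prover sends in a round. -/
def stream (P : (verifier θ).Prover) (w : List Unit) (h : List (Bool × Bool)) (t : ℕ) :
    Bool × Bool :=
  P w (sentAt h (t + 1))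

variable (h : List (Bool × Bool))

theorem val_check_receive (hq : q = VState.accept ∨ q = VState.reject) (d : Bool) (c : ZMod 8)
    (u : Bool) (p t : ℕ) :
    val θ w P q (.reading (.check d c u (stream P w h t).1)) p (sentAt h (t + 1)) ≤
      val θ w P q (.communicating (.check d c u)) p (sentAt h t) :=
  val_communicating hq (.check d c u) p (sentAt h t)

theorem val_main_receive (hq : q = VState.accept ∨ q = VState.reject) (a : Mode) (d b : Bool)
    (p t : ℕ) :
    val θ w P q (.reading (.main a d b (stream P w h t).1 (stream P w h t).2)) p
      (sentAt h (t + 1)) ≤ val θ w P q (.communicating (.main a d b)) p (sentAt h t) :=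
  val_communicating hq (.main a d b) p (sentAt h t)

theorem val_check_move_right (hq : q = VState.accept ∨ q = VState.reject) (c : ZMod 8)
    (u e : Bool) {p : ℕ} (hp : p ≤ w.length) (l : List (Bool × Bool)) :
    val θ w P q (.communicating (.check true c e)) (p + 1) l ≤
      val θ w P q (.reading (.check true c u e)) p l := by
  rw [← moveInput_right hp]
  refine val_reading_always hq ?_ l
  by_cases h0 : p = 0
  · subst h0; rfl
  · rw [inputSymbolAt_letter h0 hp]; rfl

theorem val_check_run_right (hq : q = VState.accept ∨ q = VState.reject) (c : ZMod 8) (d : ℕ) :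
    ∀ p t, p + d = w.length + 1 →
      val θ w P q (.reading (.check true c (stream P w h (t + d)).1 (stream P w h (t + d + 1)).1))
        (w.length + 1) (sentAt h (t + d + 2)) ≤
      val θ w P q (.communicating (.check true c (stream P w h t).1)) p (sentAt h (t + 1)) := by
  induction d with
  | zero =>
    intro p t hp
    obtain rfl : p = w.length + 1 := hp
    exact val_check_receive h hq _ _ _ _ _
  | succ d ih =>
    intro p t hp
    have := ih (p + 1) (t + 1) (by omega)
    rw [show t + 1 + d = t + (d + 1) by ring] at this
    exact this.trans ((val_check_move_right hq _ _ _ (by omega) _).trans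
      (val_check_receive h hq _ _ _ _ _))

theorem val_check_run_left (hq : q = VState.accept ∨ q = VState.reject) (c : ZMod 8) (p : ℕ) :
    ∀ u t, p ≤ w.length →
      val θ w P q (.communicating (.check true c (stream P w h (t + p)).1)) 1
        (sentAt h (t + p + 1)) ≤
      val θ w P q (.communicating (.check false c u)) p (sentAt h t) := by
  induction p with
  | zero =>
    intro u t _
    refine le_trans ?_ (val_check_receive h hq _ _ _ _ _)
    have := val_reading_always (θ := θ) (w := w) (P := P) hq (p := 0)
      (s := .check false c u (stream P w h t).1) rfl (sentAt h (t + 1))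
    rwa [moveInput_right (Nat.zero_le _)] at this
  | succ p ih =>
    intro u t hp
    have := ih (stream P w h t).1 (t + 1) (by omega)
    rw [show t + 1 + p = t + (p + 1) by ring] at this
    refine this.trans (le_trans ?_ (val_check_receive h hq _ _ _ _ _))
    refine val_reading_always hq (m := .left) (p := p + 1) ?_ _
    rw [inputSymbolAt_letter (by omega) hp]
    rfl

theorem val_main_run_right (hq : q = VState.accept ∨ q = VState.reject) (a : Mode) (b : Bool)
    (d : ℕ) :
    ∀ p t, p ≠ 0 → p + d = w.length + 1 →
      val θ w P q (.reading (.main a true b (stream P w h (t + d)).1 (stream P w h (t + d)).2))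
        (w.length + 1) (sentAt h (t + d + 1)) ≤
      val θ w P q (.communicating (.main a true b)) p (sentAt h t) := by
  induction d with
  | zero =>
    intro p t _ hp
    obtain rfl : p = w.length + 1 := hp
    exact val_main_receive h hq _ _ _ _ _
  | succ d ih =>
    intro p t h0 hp
    have := ih (p + 1) (t + 1) (by omega) (by omega)
    rw [show t + 1 + d = t + (d + 1) by ring] at this
    refine this.trans (le_trans ?_ (val_main_receive h hq _ _ _ _ _))
    rw [← moveInput_right (show p ≤ w.length by omega)]
    refine val_reading_always hq ?_ _
    rw [inputSymbolAt_letter h0 (by omega)]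
    rfl

theorem val_main_run_left (hq : q = VState.accept ∨ q = VState.reject) (a : Mode) (b : Bool)
    (p : ℕ) :
    ∀ t, p ≤ w.length →
      val θ w P q (.reading (.main a false b (stream P w h (t + p)).1 (stream P w h (t + p)).2)) 0
        (sentAt h (t + p + 1)) ≤
      val θ w P q (.communicating (.main a false b)) p (sentAt h t) := by
  induction p with
  | zero => exact fun t _ => val_main_receive h hq _ _ _ _ _
  | succ p ih =>
    intro t hp
    have := ih (t + 1) (by omega)
    rw [show t + 1 + p = t + (p + 1) by ring] at this
    refine this.trans (le_trans ?_ (val_main_receive h hq _ _ _ _ _))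
    refine val_reading_always hq (m := .left) (p := p + 1) ?_ _
    rw [inputSymbolAt_letter (by omega) hp]
    rfl

end Round

/-- The number of marked rows before row `i`. -/
def markCount (y : ℕ → Bool) : ℕ → ℕ
  | 0 => 0
  | i + 1 => markCount y i + if y i then 1 else 0

theorem odd_markCount_succ (y : ℕ → Bool) (i : ℕ) :
    xor (decide (Odd (markCount y i))) (y i) = decide (Odd (markCount y (i + 1))) := by
  rw [markCount]
  cases y i <;> simp [Nat.odd_add_one, -Nat.not_odd_iff_even]

/-- Lower bounds for the values of a round, relative to a reference value: `α` and `β` stand for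
acceptance and rejection, `G k i` for the check of column `k` in row `i`, `M a i` for the
comparison in mode `a` in row `i`, and `x` for the beginning of the round. -/
structure RoundBounds (θ : ℝ) (n : ℕ) (e : ℕ → ℕ → Bool) (y : ℕ → Bool) (α β x : ℝ) where
  G : ℕ → ℕ → ℝ
  M : Mode → ℕ → ℝ
  G_lower : ∀ k i, -1 ≤ G k i
  M_lower : ∀ a i, -1 ≤ M a i
  check_step : ∀ k ≤ n, ∀ i, IsCarry e k i → 1 / 2 * G k (i + 1) ≤ G k i
  check_fail : ∀ k ≤ n, ∀ i, ¬ IsCarry e k i → β ≤ G k i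
  main_fail : ∀ a i, e i 0 = false → β ≤ M a i
  main_step : ∀ a i, e i 0 = true → e i (n + 1) = false →
    weight θ a (y i) * M a (i + 1) ≤ M a i
  main_accept : ∀ i, e i 0 = true → e i (n + 1) = true → Odd (markCount y (i + 1)) →
    weight θ .acc (y i) * α ≤ M .acc i
  main_reject : ∀ a i, e i 0 = true → e i (n + 1) = true →
    a ≠ .acc ∨ ¬ Odd (markCount y (i + 1)) → weight θ a (y i) * β ≤ M a i
  start : (∀ k ≤ n, 0 ≤ G k 0) → ∀ k ≤ n, (1 / 2) ^ (n + 1) *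
    (G k 0 + (7 / 8 * M .acc 0 + 1 / 16 * M .low 0 + 1 / 16 * M .high 0)) ≤ x

/-- A walk that stops with probability `1 / 2` at each position. -/
theorem walk_bound {n : ℕ} {D Y : ℕ → ℝ} {m : ℝ} (hD : ∀ j ≤ n, 0 ≤ D j)
    (hY : ∀ j ≤ n, 1 / 2 * D j + 1 / 2 * Y (j + 1) ≤ Y j) (hm : m ≤ Y (n + 1)) {j : ℕ}
    (hj : j ≤ n) : (1 / 2) ^ (n + 1) * (D j + m) ≤ Y 0 := by
  have h1 : ∀ d p, p + d = n + 1 → (1 / 2) ^ d * m ≤ Y p := by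
    intro d
    induction d with
    | zero => rintro p rfl; simpa using hm
    | succ d ih =>
      intro p hp
      have := ih (p + 1) (by omega)
      have h2 := hY p (by omega)
      have h3 := hD p (by omega)
      rw [pow_succ]
      linarith
  have h2 : ∀ d p, p + d = j → (1 / 2) ^ (n + 1 - p) * (D j + m) ≤ Y p := by
    intro d
    induction d with
    | zero =>
      rintro p rfl
      have h3 := h1 (n - p) (p + 1) (by omega)
      have h4 := hY p hj
      have h5 : (1 / 2 : ℝ) ^ (n - p) * D p ≤ D p :=
        mul_le_of_le_one_left (hD p hj) (pow_le_one₀ (by norm_num) (by norm_num))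
      rw [show n + 1 - p = n - p + 1 by omega, pow_succ]
      simp only [add_zero] at *
      linarith
    | succ d ih =>
      intro p hp
      have h3 := ih (p + 1) (by omega)
      have h4 := hY p (by omega)
      have h5 := hD p (by omega)
      rw [show n + 1 - p = n + 1 - (p + 1) + 1 by omega, pow_succ]
      linarith
  simpa using h2 j 0 (by omega)

/-- The entries of the rows of a stream, each of length `2 * (n + 1)`. -/
def entry (s : ℕ → Bool × Bool) (n i k : ℕ) : Bool := (s (i * (2 * (n + 1)) + k)).1

/-- The marks of the rows of a stream. -/
def mark (s : ℕ → Bool × Bool) (n i : ℕ) : Bool := (s (i * (2 * (n + 1)))).2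

/-! ### One row of the stream, and the start of a round -/

section Rows

variable {θ : ℝ} {w : List Unit} {P : (verifier θ).Prover} {q : State}

/-- The trip back to the right end-marker consumes exactly one row length, so the test meets the
same two columns again. The time is `k + 2` into the row because columns `0, …, k + 1` have been
received. -/
theorem val_check_row (hq : q = VState.accept ∨ q = VState.reject) (h : List (Bool × Bool))
    (k i : ℕ) (c : ZMod 8)
    (hc : entry (stream P w h) w.length i (k + 1) =
      (entry (stream P w h) w.length i k && decide (c = 7))) :
    1 / 2 * val θ w P q (.reading (.check true
        (if entry (stream P w h) w.length i k then c + 1 else c)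
        (entry (stream P w h) w.length (i + 1) k) (entry (stream P w h) w.length (i + 1) (k + 1))))
        (w.length + 1) (sentAt h ((i + 1) * (2 * (w.length + 1)) + k + 2)) +
      1 / 2 * val θ w P q (.reading .choose) 0
        (fresh :: sentAt h (i * (2 * (w.length + 1)) + k + 2)) ≤
    val θ w P q (.reading (.check true c (entry (stream P w h) w.length i k)
      (entry (stream P w h) w.length i (k + 1))))
      (w.length + 1) (sentAt h (i * (2 * (w.length + 1)) + k + 2)) := by
  set n := w.length with hn
  set c' := if entry (stream P w h) n i k then c + 1 else c with hc'
  set T := i * (2 * (n + 1)) + k + 2 with hT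
  have hact : action θ (.check true c (entry (stream P w h) n i k)
      (entry (stream P w h) n i (k + 1))) (inputSymbolAt w (n + 1)) =
      (⟨1 / 2, by norm_num, by norm_num⟩,
        (.communicating (.check false c' (entry (stream P w h) n i (k + 1))), .left),
        (.communicating .restart, .stay)) := by
    rw [hn, inputSymbolAt_end, ← hn]
    simp only [action]
    rw [if_pos hc]
  have h1 := val_reading (P := P) hq _ (n + 1) (sentAt h T) hact
  have h2 := val_check_run_left (θ := θ) (P := P) h hq c' n
    (entry (stream P w h) n i (k + 1)) T hn.le
  have h3 := val_check_run_right (θ := θ) (P := P) h hq c' n 1 (T + n)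
    (by rw [← hn, Nat.add_comm])
  have h4 := val_restart (θ := θ) (w := w) (P := P) hq (n + 1) (sentAt h T)
  simp only [moveInput, Nat.add_sub_cancel] at h1
  have e1 : T + n + n = (i + 1) * (2 * (n + 1)) + k := by rw [hT]; ring
  rw [e1] at h3
  have h5 := h3.trans h2
  simp only [entry, add_assoc] at *
  linarith

theorem val_check_fail (hq : q = VState.accept ∨ q = VState.reject) (l : List (Bool × Bool))
    (d u e : Bool) (c : ZMod 8) (hc : ¬ e = (u && decide (c = 7))) :
    val θ w P q .reject (w.length + 1) l ≤
      val θ w P q (.reading (.check d c u e)) (w.length + 1) l := by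
  refine val_reading_always hq (m := .stay) ?_ l
  rw [inputSymbolAt_end]
  simp only [action]
  rw [if_neg hc]

theorem val_main_fail (hq : q = VState.accept ∨ q = VState.reject) (l : List (Bool × Bool))
    (a : Mode) (d b y : Bool) :
    val θ w P q .reject (w.length + 1) l ≤
      val θ w P q (.reading (.main a d b false y)) (w.length + 1) l := by
  refine val_reading_always hq (m := .stay) ?_ l
  rw [inputSymbolAt_end]
  simp [action]

theorem val_main_turn (hθ0 : 0 ≤ θ) (hθ1 : θ ≤ 1) (hq : q = VState.accept ∨ q = VState.reject)
    (h : List (Bool × Bool)) (a : Mode) (b : Bool) (i : ℕ)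
    (he : entry (stream P w h) w.length i 0 = true) :
    -- `y'` is the mark component of the symbol received at the left end-marker; it is ignored
    -- there.
    ∃ y', weight θ a (mark (stream P w h) w.length i) *
        val θ w P q (.reading (.main a false (xor b (mark (stream P w h) w.length i))
          (entry (stream P w h) w.length i (w.length + 1)) y')) 0
          (sentAt h (i * (2 * (w.length + 1)) + w.length + 2)) +
      (1 - weight θ a (mark (stream P w h) w.length i)) * val θ w P q (.reading .choose) 0
        (fresh :: sentAt h (i * (2 * (w.length + 1)) + 1)) ≤
    val θ w P q (.reading (.main a true b (entry (stream P w h) w.length i 0)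
      (mark (stream P w h) w.length i)))
      (w.length + 1) (sentAt h (i * (2 * (w.length + 1)) + 1)) := by
  set n := w.length with hn
  set T := i * (2 * (n + 1)) + 1 with hT
  set y := mark (stream P w h) n i with hy
  have hw1 := weight_le_half hθ0 hθ1 a y
  have hw0 := weight_pos θ a y
  have hact : action θ (.main a true b (entry (stream P w h) n i 0) y)
      (inputSymbolAt w (n + 1)) =
      (Set.projIcc 0 1 zero_le_one (weight θ a y),
        (.communicating (.main a false (xor b y)), .left), (.communicating .restart, .stay)) := by
    rw [hn, inputSymbolAt_end, ← hn]
    simp only [action]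
    rw [if_pos he]
  have h1 := val_reading (P := P) hq _ (n + 1) (sentAt h T) hact
  rw [Set.projIcc_of_mem zero_le_one ⟨hw0.le, by linarith⟩] at h1
  have h2 := val_main_run_left (θ := θ) (P := P) h hq a (xor b y) n T hn.le
  have h4 := val_restart (θ := θ) (w := w) (P := P) hq (n + 1) (sentAt h T)
  simp only [moveInput, Nat.add_sub_cancel] at h1
  have e1 : T + n = i * (2 * (n + 1)) + (n + 1) := by rw [hT]; ring
  rw [e1] at h2
  refine ⟨_, le_trans (add_le_add (mul_le_mul_of_nonneg_left h2 hw0.le)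
    (mul_le_mul_of_nonneg_left h4 (by linarith))) h1⟩

theorem val_main_row (hθ0 : 0 ≤ θ) (hθ1 : θ ≤ 1) (hq : q = VState.accept ∨ q = VState.reject)
    (h : List (Bool × Bool)) (a : Mode) (b : Bool) (i : ℕ)
    (he : entry (stream P w h) w.length i 0 = true)
    (he' : entry (stream P w h) w.length i (w.length + 1) = false) :
    weight θ a (mark (stream P w h) w.length i) *
        val θ w P q (.reading (.main a true (xor b (mark (stream P w h) w.length i))
          (entry (stream P w h) w.length (i + 1) 0) (mark (stream P w h) w.length (i + 1))))
          (w.length + 1) (sentAt h ((i + 1) * (2 * (w.length + 1)) + 1)) +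
      (1 - weight θ a (mark (stream P w h) w.length i)) * val θ w P q (.reading .choose) 0
        (fresh :: sentAt h (i * (2 * (w.length + 1)) + 1)) ≤
    val θ w P q (.reading (.main a true b (entry (stream P w h) w.length i 0)
      (mark (stream P w h) w.length i)))
      (w.length + 1) (sentAt h (i * (2 * (w.length + 1)) + 1)) := by
  obtain ⟨y', hy'⟩ := val_main_turn hθ0 hθ1 hq h a b i he
  refine le_trans (add_le_add_left (mul_le_mul_of_nonneg_left ?_ (weight_pos ..).le) _) hy'
  set b' := xor b (mark (stream P w h) w.length i)
  have h1 := val_main_run_right (θ := θ) (P := P) h hq a b' w.length 1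
    (i * (2 * (w.length + 1)) + w.length + 2) one_ne_zero (Nat.add_comm ..)
  have e1 : i * (2 * (w.length + 1)) + w.length + 2 + w.length =
    (i + 1) * (2 * (w.length + 1)) := by ring
  rw [e1] at h1
  refine h1.trans ?_
  have h2 := val_reading_always (θ := θ) (P := P) (w := w) hq (p := 0) (m := .right)
    (s := .main a false b' (entry (stream P w h) w.length i (w.length + 1)) y')
    (s' := .communicating (.main a true b'))
    (by rw [inputSymbolAt_zero, he']; rfl) (sentAt h (i * (2 * (w.length + 1)) + w.length + 2))
  rwa [moveInput_right (Nat.zero_le _)] at h2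

theorem val_main_last (hθ0 : 0 ≤ θ) (hθ1 : θ ≤ 1) (hq : q = VState.accept ∨ q = VState.reject)
    (h : List (Bool × Bool)) (a : Mode) (b : Bool) (i : ℕ)
    (he : entry (stream P w h) w.length i 0 = true)
    (he' : entry (stream P w h) w.length i (w.length + 1) = true) {s : State}
    (hs : ∀ y', action θ (.main a false (xor b (mark (stream P w h) w.length i)) true y')
      .leftEnd = .always s .stay) :
    weight θ a (mark (stream P w h) w.length i) *
        val θ w P q s 0 (sentAt h (i * (2 * (w.length + 1)) + w.length + 2)) +
      (1 - weight θ a (mark (stream P w h) w.length i)) * val θ w P q (.reading .choose) 0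
        (fresh :: sentAt h (i * (2 * (w.length + 1)) + 1)) ≤
    val θ w P q (.reading (.main a true b (entry (stream P w h) w.length i 0)
      (mark (stream P w h) w.length i)))
      (w.length + 1) (sentAt h (i * (2 * (w.length + 1)) + 1)) := by
  obtain ⟨y', hy'⟩ := val_main_turn hθ0 hθ1 hq h a b i he
  refine le_trans (add_le_add_left (mul_le_mul_of_nonneg_left ?_ (weight_pos ..).le) _) hy'
  refine val_reading_always hq (p := 0) (m := .stay) ?_ _
  rw [inputSymbolAt_zero, he']
  exact hs y'

/-- From position `n - k` the head needs `k + 1` moves to the right end-marker, where it holds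
columns `k` and `k + 1`. At least one move is made, so the initial `prev` is overwritten. -/
theorem val_start_check (hq : q = VState.accept ∨ q = VState.reject) (h : List (Bool × Bool))
    {k : ℕ} (hk : k ≤ w.length) :
    val θ w P q (.reading (.check true 0 (entry (stream P w h) w.length 0 k)
        (entry (stream P w h) w.length 0 (k + 1)))) (w.length + 1) (sentAt h (k + 2)) ≤
      val θ w P q (.communicating (.check true 0 false)) (w.length - k) h := by
  have h1 := val_check_run_right (θ := θ) (w := w) (P := P) h hq 0 k (w.length - k + 1) 0 (by omega)
  have h2 := val_check_move_right (θ := θ) (P := P) hq 0 false (stream P w h 0).1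
    (show w.length - k ≤ w.length by omega) (sentAt h 1)
  have h3 := val_check_receive (θ := θ) (P := P) (w := w) h hq true 0 false (w.length - k) 0
  have h4 := (h1.trans h2).trans h3
  simpa [entry, sentAt, add_assoc] using h4

theorem val_choose_letter (hq : q = VState.accept ∨ q = VState.reject) (h : List (Bool × Bool))
    {p : ℕ} (hp : p ≤ w.length) :
    1 / 2 * val θ w P q (.communicating (.check true 0 false)) p h +
      1 / 2 * val θ w P q (.reading .choose) (p + 1) h ≤
      val θ w P q (.reading .choose) p h := by
  have hact : action θ .choose (inputSymbolAt w p) = (⟨1 / 2, by norm_num, by norm_num⟩,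
      (.communicating (.check true 0 false), .stay), (.reading .choose, .right)) := by
    by_cases h0 : p = 0
    · subst h0; rfl
    · rw [inputSymbolAt_letter h0 hp]; rfl
  have := val_reading (P := P) hq _ p h hact
  rw [moveInput_right hp] at this
  simp only [moveInput] at this
  linarith

theorem val_choose_end (hq : q = VState.accept ∨ q = VState.reject) (h : List (Bool × Bool)) :
    7 / 8 * val θ w P q (.communicating (.main .acc true false)) (w.length + 1) h +
      1 / 16 * val θ w P q (.communicating (.main .low true false)) (w.length + 1) h +
      1 / 16 * val θ w P q (.communicating (.main .high true false)) (w.length + 1) h ≤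
      val θ w P q (.reading .choose) (w.length + 1) h := by
  have hact : action θ .choose (inputSymbolAt w (w.length + 1)) =
      (⟨7 / 8, by norm_num, by norm_num⟩,
        (.communicating (.main .acc true false), .stay), (.reading .pick, .stay)) := by
    rw [inputSymbolAt_end]; rfl
  have h1 := val_reading (P := P) hq _ (w.length + 1) h hact
  have h2 : _ ≤ val θ w P q (.reading .pick) (w.length + 1) h :=
    val_reading (P := P) hq _ (w.length + 1) h rfl
  simp only [moveInput] at h1 h2
  linarith

/-- The bounds for a round, relative to a lower bound `ρ` for the value of later rounds. -/
noncomputable def roundBounds (hθ0 : 0 ≤ θ) (hθ1 : θ ≤ 1)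
    (hq : q = VState.accept ∨ q = VState.reject) {ρ α β : ℝ} (hρ : ρ ≤ 1)
    (hlater : ∀ l, ρ ≤ val θ w P q (.reading .choose) 0 (fresh :: l))
    (hα : ∀ p l, α ≤ val θ w P q .accept p l - ρ) (hβ : ∀ p l, β ≤ val θ w P q .reject p l - ρ)
    (h : List (Bool × Bool)) :
    RoundBounds θ w.length (entry (stream P w h) w.length) (mark (stream P w h) w.length) α β
      (val θ w P q (.reading .choose) 0 h - ρ) where
  G k i := val θ w P q (.reading (.check true
    (columnCount (entry (stream P w h) w.length) k i) (entry (stream P w h) w.length i k)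
    (entry (stream P w h) w.length i (k + 1))))
    (w.length + 1) (sentAt h (i * (2 * (w.length + 1)) + k + 2)) - ρ
  M a i := val θ w P q (.reading (.main a true
    (decide (Odd (markCount (mark (stream P w h) w.length) i)))
    (entry (stream P w h) w.length i 0) (mark (stream P w h) w.length i)))
    (w.length + 1) (sentAt h (i * (2 * (w.length + 1)) + 1)) - ρ
  G_lower k i := by
    have : 0 ≤ val θ w P q (.reading (.check true
      (columnCount (entry (stream P w h) w.length) k i) (entry (stream P w h) w.length i k)
      (entry (stream P w h) w.length i (k + 1))))
      (w.length + 1) (sentAt h (i * (2 * (w.length + 1)) + k + 2)) := val_nonneg ..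
    linarith
  M_lower a i := by
    have : 0 ≤ val θ w P q (.reading (.main a true
      (decide (Odd (markCount (mark (stream P w h) w.length) i)))
      (entry (stream P w h) w.length i 0) (mark (stream P w h) w.length i)))
      (w.length + 1) (sentAt h (i * (2 * (w.length + 1)) + 1)) := val_nonneg ..
    linarith
  check_step k _ i hc := by
    -- Once the restart value is bounded below by `ρ`, subtracting `ρ` leaves only the surviving
    -- branch; the same happens in the comparison modes.
    have h1 := val_check_row hq h k i _ hc
    have h2 := hlater (sentAt h (i * (2 * (w.length + 1)) + k + 2))
    rw [columnCount]
    linarith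
  check_fail k _ i hc :=
    (hβ _ _).trans (sub_le_sub_right (val_check_fail hq _ true _ _ _ hc) ρ)
  main_fail a i he := by
    rw [he]
    exact (hβ _ _).trans (sub_le_sub_right (val_main_fail hq _ a true _ _) ρ)
  main_step a i he he' := by
    have h1 := val_main_row hθ0 hθ1 hq h a
      (decide (Odd (markCount (mark (stream P w h) w.length) i))) i he he'
    have h2 := hlater (sentAt h (i * (2 * (w.length + 1)) + 1))
    have h3 := weight_le_half hθ0 hθ1 a (mark (stream P w h) w.length i)
    have h4 := mul_le_mul_of_nonneg_left h2 (sub_nonneg.2 (h3.trans (by norm_num : (1 / 2 : ℝ) ≤ 1)))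
    rw [odd_markCount_succ] at h1
    linarith
  main_accept i he he' hodd := by
    have h1 := val_main_last (s := .accept) hθ0 hθ1 hq h .acc
      (decide (Odd (markCount (mark (stream P w h) w.length) i))) i he he'
      (by rw [odd_markCount_succ, decide_eq_true hodd]; exact fun _ => rfl)
    have h2 := hlater (sentAt h (i * (2 * (w.length + 1)) + 1))
    have h3 := weight_le_half hθ0 hθ1 .acc (mark (stream P w h) w.length i)
    have h4 := mul_le_mul_of_nonneg_left h2 (sub_nonneg.2 (h3.trans (by norm_num : (1 / 2 : ℝ) ≤ 1)))
    have h5 := mul_le_mul_of_nonneg_left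
      (hα 0 (sentAt h (i * (2 * (w.length + 1)) + w.length + 2)))
      (weight_pos θ .acc (mark (stream P w h) w.length i)).le
    linarith
  main_reject a i he he' hodd := by
    have h1 := val_main_last (s := .reject) hθ0 hθ1 hq h a
      (decide (Odd (markCount (mark (stream P w h) w.length) i))) i he he' (by
        rw [odd_markCount_succ]
        intro y'
        rcases hodd with hodd | hodd
        · cases a
          · exact absurd rfl hodd
          · rfl
          · rfl
        · rw [decide_eq_false hodd]
          cases a <;> rfl)
    have h2 := hlater (sentAt h (i * (2 * (w.length + 1)) + 1))
    have h3 := weight_le_half hθ0 hθ1 a (mark (stream P w h) w.length i)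
    have h4 := mul_le_mul_of_nonneg_left h2 (sub_nonneg.2 (h3.trans (by norm_num : (1 / 2 : ℝ) ≤ 1)))
    have h5 := mul_le_mul_of_nonneg_left
      (hβ 0 (sentAt h (i * (2 * (w.length + 1)) + w.length + 2)))
      (weight_pos θ a (mark (stream P w h) w.length i)).le
    linarith
  start hG k hk := by
    simp only [columnCount, zero_mul, zero_add] at hG ⊢
    have hmain : ∀ a, val θ w P q (.reading (.main a true
        (decide (Odd (markCount (mark (stream P w h) w.length) 0)))
        (entry (stream P w h) w.length 0 0) (mark (stream P w h) w.length 0)))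
        (w.length + 1) (sentAt h 1) ≤
        val θ w P q (.communicating (.main a true false)) (w.length + 1) h := fun a => by
      simpa [entry, mark, markCount, sentAt] using
        val_main_receive (θ := θ) (P := P) (w := w) h hq a true false (w.length + 1) 0
    have hend := val_choose_end (θ := θ) (w := w) (P := P) hq h
    -- Stopping at position `j` starts the test of column `n - j`.
    have hcheck : ∀ j ≤ w.length, _ := fun j hj =>
      val_start_check (θ := θ) (w := w) (P := P) hq h (show w.length - j ≤ w.length by omega)
    have hwalk := walk_bound (n := w.length) (j := w.length - k)
      (D := fun j => val θ w P q (.communicating (.check true 0 false)) j h - ρ)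
      (Y := fun j => val θ w P q (.reading .choose) j h - ρ)
      (m := val θ w P q (.reading .choose) (w.length + 1) h - ρ)
      (fun j hj => by
        have h1 := hcheck j hj
        have h2 := hG (w.length - j) (by omega)
        rw [show w.length - (w.length - j) = j by omega] at h1
        linarith)
      (fun j hj => by
        have := val_choose_letter (θ := θ) (w := w) (P := P) hq h hj
        linarith) le_rfl (by omega)
    refine le_trans (mul_le_mul_of_nonneg_left ?_ (by positivity)) hwalk
    have h1 := val_start_check (θ := θ) (w := w) (P := P) hq h hk
    have h2 := hmain .acc
    have h3 := hmain .low
    have h4 := hmain .high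
    linarith

end Rows

end UnaryVerifier

/-! ### Analysis of a round -/

namespace UnaryVerifier

/-- A bounded sequence with `D i ≥ D (i + 1) / 2` is nonnegative. -/
theorem nonneg_of_half_le {D : ℕ → ℝ} (hD : ∀ i, -1 ≤ D i)
    (h : ∀ i, 0 ≤ D i ∨ 1 / 2 * D (i + 1) ≤ D i) (i : ℕ) : 0 ≤ D i := by
  -- Iterating `m` times leaves at worst `2 ^ (-m)` of the lower bound `-1`.
  have key : ∀ m i, -(1 / 2 : ℝ) ^ m ≤ D i := by
    intro m
    induction m with
    | zero => simpa using hD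
    | succ m ih =>
      intro i
      have h0 : (0 : ℝ) ≤ (1 / 2) ^ m := by positivity
      rcases h i with h1 | h1
      · rw [pow_succ]; linarith
      · have := ih (i + 1)
        rw [pow_succ]; linarith
  have hlim : Filter.Tendsto (fun m : ℕ => -(1 / 2 : ℝ) ^ m) Filter.atTop (nhds 0) := by
    simpa using (tendsto_pow_atTop_nhds_zero_of_lt_one (r := (1 / 2 : ℝ)) (by norm_num)
      (by norm_num)).neg
  exact le_of_tendsto' hlim fun m => key m i

variable {θ : ℝ} {n : ℕ} {e : ℕ → ℕ → Bool} {y : ℕ → Bool} {α β x : ℝ}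

namespace RoundBounds

variable (B : RoundBounds θ n e y α β x)

/-- A test loses nothing unless it fails. The hypothesis is conditional on a failure so that it also
covers the honest prover, for whom `β = -ρ` but no test fails. -/
theorem check_nonneg (hβ : ∀ k ≤ n, ∀ i, ¬ IsCarry e k i → 0 ≤ β) {k : ℕ} (hk : k ≤ n) (i : ℕ) :
    0 ≤ B.G k i := by
  refine nonneg_of_half_le (B.G_lower k) (fun i => ?_) i
  by_cases hc : IsCarry e k i
  · exact Or.inr (B.check_step k hk i hc)
  · exact Or.inl ((hβ k hk i hc).trans (B.check_fail k hk i hc))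

/-- Modes `low` and `high` never accept, so when rejection is the right verdict they can only fail
to gain. -/
theorem mode_nonneg (hθ0 : 0 ≤ θ) (hθ1 : θ ≤ 1) (hβ : 0 ≤ β) {a : Mode} (ha : a ≠ .acc) (i : ℕ) :
    0 ≤ B.M a i := by
  refine nonneg_of_half_le (B.M_lower a) (fun i => ?_) i
  have hw0 := weight_pos θ a (y i)
  have hw1 := weight_le_half hθ0 hθ1 a (y i)
  cases h0 : e i 0
  · exact Or.inl (hβ.trans (B.main_fail a i h0))
  · cases h1 : e i (n + 1)
    · have h2 := B.main_step a i h0 h1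
      rcases le_total 0 (B.M a (i + 1)) with h3 | h3
      · exact Or.inl ((mul_nonneg hw0.le h3).trans h2)
      · exact Or.inr ((mul_le_mul_of_nonpos_right hw1 h3).trans h2)
    · exact Or.inl ((mul_nonneg hw0.le hβ).trans (B.main_reject a i h0 h1 (Or.inl ha)))

/-- Unless the row is rejected at once, any loss comes after surviving it, which has probability `1
/ 512`. -/
theorem acc_lower (hα : -1 ≤ α) (hβ : 0 ≤ β) (i : ℕ) : -(1 / 512) ≤ B.M .acc i := by
  cases h0 : e i 0
  · have := B.main_fail .acc i h0
    linarith
  · cases h1 : e i (n + 1)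
    · have h2 := B.main_step .acc i h0 h1
      have h3 := B.M_lower .acc (i + 1)
      rw [weight] at h2
      linarith
    · by_cases ho : Odd (markCount y (i + 1))
      · have := B.main_accept i h0 h1 ho
        rw [weight] at this
        linarith
      · have := B.main_reject .acc i h0 h1 (Or.inr ho)
        rw [weight] at this
        linarith

theorem le_check_of_not_isCarry (hβ : 0 ≤ β) {k : ℕ} (hk : k ≤ n) (d : ℕ) :
    ∀ i, ¬ IsCarry e k (i + d) → (1 / 2) ^ d * β ≤ B.G k i := by
  induction d with
  | zero => intro i hi; simpa using B.check_fail k hk i hi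
  | succ d ih =>
    intro i hi
    by_cases hc : IsCarry e k i
    · have h1 := B.check_step k hk i hc
      have h2 := ih (i + 1) (by rwa [show i + 1 + d = i + (d + 1) by ring])
      rw [pow_succ]
      linarith
    · exact (mul_le_of_le_one_left hβ (pow_le_one₀ (by norm_num) (by norm_num))).trans
        (B.check_fail k hk i hc)

theorem prod_weight_mul_le (a : Mode) {I : ℕ} (h0 : ∀ i < I, e i 0 = true)
    (h1 : ∀ i < I, e i (n + 1) = false) :
    (∏ i ∈ Finset.range I, weight θ a (y i)) * B.M a I ≤ B.M a 0 := by
  induction I with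
  | zero => simp
  | succ I ih =>
    refine le_trans ?_ (ih (fun i hi => h0 i (by omega)) fun i hi => h1 i (by omega))
    rw [Finset.prod_range_succ, mul_assoc]
    exact mul_le_mul_of_nonneg_left (B.main_step a I (h0 I (by omega)) (h1 I (by omega)))
      (Finset.prod_nonneg fun i _ => (weight_pos θ a _).le)

/-- A stream that describes the counter correctly ends after `8 ^ (n + 1)` rows. -/
theorem complete_run (a : Mode) {v : ℝ}
    (he : ∀ i < 8 ^ (n + 1), ∀ k ≤ n + 1, e i k = decide (8 ^ k ∣ i + 1))
    (hv : a = .acc ∧ Odd (markCount y (8 ^ (n + 1))) ∧ v = α ∨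
      (a ≠ .acc ∨ ¬ Odd (markCount y (8 ^ (n + 1)))) ∧ v = β) :
    (∏ i ∈ Finset.range (8 ^ (n + 1)), weight θ a (y i)) * v ≤ B.M a 0 := by
  obtain ⟨I, hI⟩ : ∃ I, 8 ^ (n + 1) = I + 1 :=
    Nat.exists_eq_succ_of_ne_zero (by positivity)
  have h0 : ∀ i ≤ I, e i 0 = true := fun i hi => by rw [he i (by omega) 0 (by omega)]; simp
  have h1 : ∀ i < I, e i (n + 1) = false := fun i hi => by
    rw [he i (by omega) _ le_rfl, hI, decide_eq_false_iff_not]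
    exact fun hd => by have := Nat.le_of_dvd (by omega) hd; omega
  have h2 : e I (n + 1) = true := by rw [he I (by omega) _ le_rfl, hI]; simp
  refine le_trans ?_ (B.prod_weight_mul_le a (fun i hi => h0 i hi.le) h1)
  rw [hI] at hv ⊢
  rw [Finset.prod_range_succ, mul_assoc]
  refine mul_le_mul_of_nonneg_left ?_ (Finset.prod_nonneg fun i _ => (weight_pos θ a _).le)
  rcases hv with ⟨rfl, ho, rfl⟩ | ⟨ho, rfl⟩
  · exact B.main_accept I (h0 I le_rfl) h2 ho
  · exact B.main_reject a I (h0 I le_rfl) h2 ho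

end RoundBounds

/-! ### Survival weights over many rows -/

theorem prod_weight_acc (θ : ℝ) (y : ℕ → Bool) (N : ℕ) :
    ∏ i ∈ Finset.range N, weight θ .acc (y i) = (1 / 512) ^ N := by
  simp [weight]

/-- Exponents add up row by row, so survival compares the number of marks with `θ * N` without
storing either. -/
theorem prod_weight_low (θ : ℝ) (y : ℕ → Bool) (N : ℕ) :
    ∏ i ∈ Finset.range N, weight θ .low (y i) =
      (1 / 512) ^ N * (256 : ℝ) ^ ((markCount y N : ℝ) - θ * N) := by
  induction N with
  | zero => simp [markCount]
  | succ N ih =>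
    rw [Finset.prod_range_succ, ih, weight, markCount, pow_succ,
      show (((markCount y N + if y N then 1 else 0 : ℕ) : ℝ) - θ * ((N + 1 : ℕ) : ℝ)) =
        ((markCount y N : ℝ) - θ * N) + ((if y N then 1 else 0) - θ) by
        push_cast; ring, Real.rpow_add (by norm_num)]
    ring

theorem prod_weight_high (θ : ℝ) (y : ℕ → Bool) (N : ℕ) :
    ∏ i ∈ Finset.range N, weight θ .high (y i) =
      (1 / 512) ^ N * (256 : ℝ) ^ (θ * N - (markCount y N : ℝ)) := by
  induction N with
  | zero => simp [markCount]
  | succ N ih =>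
    rw [Finset.prod_range_succ, ih, weight, markCount, pow_succ,
      show (θ * ((N + 1 : ℕ) : ℝ) - ((markCount y N + if y N then 1 else 0 : ℕ) : ℝ)) =
        (θ * N - (markCount y N : ℝ)) + (θ - (if y N then 1 else 0)) by
        push_cast; ring, Real.rpow_add (by norm_num)]
    ring

theorem rpow_256_quarter : (256 : ℝ) ^ (1 / 4 : ℝ) = 4 := by
  rw [show (256 : ℝ) = 4 ^ (4 : ℝ) by norm_num, ← Real.rpow_mul (by norm_num)]
  norm_num

theorem rpow_256_three_quarters : (256 : ℝ) ^ (3 / 4 : ℝ) = 64 := by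
  rw [show (256 : ℝ) = 4 ^ (4 : ℝ) by norm_num, ← Real.rpow_mul (by norm_num)]
  norm_num

/-- Different parity forces `m ≥ M + 1` or `m ≤ M - 1`, while `t` lies in `[M, M + 1 / 4]`. -/
theorem dist_of_odd {m M : ℕ} {t : ℝ} (hm : Odd m) (hM : ¬ Odd M) (h0 : (M : ℝ) ≤ t)
    (h1 : t ≤ M + 1 / 4) : 3 / 4 ≤ m - t ∨ 3 / 4 ≤ t - m := by
  have hne : m ≠ M := fun h => hM (h ▸ hm)
  rcases lt_or_gt_of_ne hne with h | h
  · right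
    have : ((m + 1 : ℕ) : ℝ) ≤ M := by exact_mod_cast h
    push_cast at this
    linarith
  · left
    have : ((M + 1 : ℕ) : ℝ) ≤ m := by exact_mod_cast h
    push_cast at this
    linarith

/-- A round gains by a factor that depends only on the length of the input: the case of an honest
prover and a member of the language. -/
theorem completeness_bound {ρ : ℝ} (B : RoundBounds θ n e y (1 - ρ) (-ρ) x)
    (hρ0 : 0 ≤ ρ) (hρ1 : ρ ≤ 7 / 10) (he : ∀ i, ∀ k ≤ n + 1, e i k = decide (8 ^ k ∣ i + 1))
    (hodd : Odd (markCount y (8 ^ (n + 1))))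
    (h0 : (markCount y (8 ^ (n + 1)) : ℝ) ≤ θ * 8 ^ (n + 1))
    (h1 : θ * 8 ^ (n + 1) ≤ markCount y (8 ^ (n + 1)) + 1 / 4) :
    (1 / 2) ^ (n + 1) * (1 / 512) ^ (8 ^ (n + 1)) * (7 / 10 - ρ) ≤ x := by
  have hG : ∀ k ≤ n, ∀ i, 0 ≤ B.G k i := fun k hk =>
    B.check_nonneg (fun k hk i hc => absurd (isCarry_of_dvd he hk i) hc) hk
  refine le_trans ?_ (B.start (fun k hk => hG k hk 0) 0 (Nat.zero_le n))
  rw [mul_assoc]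
  refine mul_le_mul_of_nonneg_left ?_ (by positivity)
  have ha := B.complete_run .acc (fun i _ => he i) (Or.inl ⟨rfl, hodd, rfl⟩)
  have hl := B.complete_run .low (fun i _ => he i) (Or.inr ⟨Or.inl nofun, rfl⟩)
  have hh := B.complete_run .high (fun i _ => he i) (Or.inr ⟨Or.inl nofun, rfl⟩)
  rw [prod_weight_acc] at ha
  rw [prod_weight_low] at hl
  rw [prod_weight_high] at hh
  push_cast at hl hh
  have hl' : (256 : ℝ) ^ ((markCount y (8 ^ (n + 1)) : ℝ) - θ * 8 ^ (n + 1)) ≤ 1 :=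
    Real.rpow_le_one_of_one_le_of_nonpos (by norm_num) (by linarith)
  have hh' : (256 : ℝ) ^ (θ * 8 ^ (n + 1) - (markCount y (8 ^ (n + 1)) : ℝ)) ≤ 4 := by
    rw [← rpow_256_quarter]
    exact Real.rpow_le_rpow_of_exponent_le (by norm_num) (by linarith)
  have hc := hG 0 (Nat.zero_le n) 0
  set W : ℝ := (1 / 512) ^ (8 ^ (n + 1)) with hW
  have hWpos : 0 < W := by positivity
  have hl2 := mul_le_mul_of_nonneg_left hl' (mul_nonneg hWpos.le hρ0)
  have hh2 := mul_le_mul_of_nonneg_left hh' (mul_nonneg hWpos.le hρ0)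
  -- Here `5 / 16 = (1 + 4) / 16` is the largest rejection weight of `low` and `high`.
  have : 0 ≤ W * (7 / 8 * (1 - ρ) - 5 / 16 * ρ - (7 / 10 - ρ)) :=
    mul_nonneg hWpos.le (by linarith)
  linarith

/-- A round gains by a factor that depends only on the length of the input: the case of a nonmember
of the language. -/
theorem soundness_bound {ρ : ℝ} (B : RoundBounds θ n e y (-ρ) (1 - ρ) x)
    (hθ0 : 0 ≤ θ) (hθ1 : θ ≤ 1) (hρ0 : 0 ≤ ρ) (hρ1 : ρ ≤ 7 / 10) {M : ℕ} (hM : ¬ Odd M)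
    (h0 : (M : ℝ) ≤ θ * 8 ^ (n + 1)) (h1 : θ * 8 ^ (n + 1) ≤ M + 1 / 4) :
    (1 / 2) ^ (n + 1) * (1 / 512) ^ (8 ^ (n + 1)) * (7 / 10 - ρ) ≤ x := by
  have hβ : 0 ≤ 1 - ρ := by linarith
  have hG : ∀ k ≤ n, ∀ i, 0 ≤ B.G k i := fun k hk => B.check_nonneg (fun _ _ _ _ => hβ) hk
  have hlow := B.mode_nonneg hθ0 hθ1 hβ (a := .low) nofun 0
  have hhigh := B.mode_nonneg hθ0 hθ1 hβ (a := .high) nofun 0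
  have hpow : ∀ I ≤ 8 ^ (n + 1), (1 / 512 : ℝ) ^ (8 ^ (n + 1)) ≤ (1 / 512) ^ I := fun I hI =>
    pow_le_pow_of_le_one (by norm_num) (by norm_num) hI
  have hWpos : (0 : ℝ) < (1 / 512) ^ (8 ^ (n + 1)) := by positivity
  rw [mul_assoc]
  by_cases hbad : ∃ i, i < 8 ^ (n + 1) ∧ ¬ (e i 0 = true ∧ ∀ k ≤ n, IsCarry e k i)
  -- Take the first faulty row `I`. Before it the counter is correct and has not ended, so no
  -- verdict has been reached in `acc`.
  · classical
    obtain ⟨hI, hIbad⟩ := Nat.find_spec hbad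
    have hmin : ∀ i < Nat.find hbad, e i 0 = true ∧ ∀ k ≤ n, IsCarry e k i := fun i hi => by
      have := Nat.find_min hbad hi
      push Not at this
      exact this (hi.trans hI)
    set I := Nat.find hbad
    have he := dvd_of_isCarry (fun i hi => (hmin i hi).1) fun i hi => (hmin i hi).2
    have hend : ∀ i < I, e i (n + 1) = false := fun i hi => by
      rw [he _ le_rfl i hi, decide_eq_false_iff_not]
      exact fun hd => by have := Nat.le_of_dvd (by omega) hd; omega
    have hacc := B.prod_weight_mul_le .acc (fun i hi => (hmin i hi).1) hend
    rw [prod_weight_acc] at hacc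
    have hpI := hpow I hI.le
    by_cases hcol : e I 0 = true
    · have hk : ∃ k ≤ n, ¬ IsCarry e k I := by
        by_contra hcon
        push Not at hcon
        exact hIbad ⟨hcol, hcon⟩
      obtain ⟨k, hk, hkI⟩ := hk
      refine le_trans ?_ (B.start (fun k hk => hG k hk 0) k hk)
      refine mul_le_mul_of_nonneg_left ?_ (by positivity)
      -- The test of column `k` gains at least `2 ^ (-I) * (1 - ρ)`, while `acc` loses at most `512
      -- ^ (-I) * 7 / 4096`.
      have hc := B.le_check_of_not_isCarry hβ hk I 0 (by rwa [zero_add])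
      have hl := mul_le_mul_of_nonneg_left (B.acc_lower (by linarith) hβ I)
        (by positivity : (0 : ℝ) ≤ (1 / 512) ^ I)
      have hp2 : (1 / 512 : ℝ) ^ I ≤ (1 / 2) ^ I :=
        pow_le_pow_left₀ (by norm_num) (by norm_num) I
      have h3 := mul_le_mul_of_nonneg_right (hpI.trans hp2) (by linarith : 0 ≤ 7 / 10 - ρ)
      linarith
    · refine le_trans ?_ (B.start (fun k hk => hG k hk 0) 0 (Nat.zero_le n))
      refine mul_le_mul_of_nonneg_left ?_ (by positivity)
      have hfail := B.main_fail .acc I (by simpa using hcol)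
      have h3 := mul_le_mul_of_nonneg_left hfail (by positivity : (0 : ℝ) ≤ (1 / 512) ^ I)
      have h4 := mul_le_mul_of_nonneg_right hpI hβ
      have hc := hG 0 (Nat.zero_le n) 0
      have : 0 ≤ (1 / 512 : ℝ) ^ (8 ^ (n + 1)) * (7 / 8 * (1 - ρ) - (7 / 10 - ρ)) :=
        mul_nonneg hWpos.le (by linarith)
      linarith
  · push Not at hbad
    have he := dvd_of_isCarry (fun i hi => (hbad i hi).1) fun i hi => (hbad i hi).2
    have he' : ∀ i < 8 ^ (n + 1), ∀ k ≤ n + 1, e i k = decide (8 ^ k ∣ i + 1) :=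
      fun i hi k hk => he k hk i hi
    refine le_trans ?_ (B.start (fun k hk => hG k hk 0) 0 (Nat.zero_le n))
    refine mul_le_mul_of_nonneg_left ?_ (by positivity)
    have hc := hG 0 (Nat.zero_le n) 0
    by_cases hodd : Odd (markCount y (8 ^ (n + 1)))
    · have ha := B.complete_run .acc he' (Or.inl ⟨rfl, hodd, rfl⟩)
      have hl := B.complete_run .low he' (Or.inr ⟨Or.inl nofun, rfl⟩)
      have hh := B.complete_run .high he' (Or.inr ⟨Or.inl nofun, rfl⟩)
      rw [prod_weight_acc] at ha
      rw [prod_weight_low] at hl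
      rw [prod_weight_high] at hh
      push_cast at hl hh
      have key : ∀ t : ℝ, 3 / 4 ≤ t → (64 : ℝ) ≤ 256 ^ t := fun t ht => by
        rw [← rpow_256_three_quarters]
        exact Real.rpow_le_rpow_of_exponent_le (by norm_num) ht
      have hWβ := mul_nonneg hWpos.le hβ
      have : 0 ≤ (1 / 512 : ℝ) ^ (8 ^ (n + 1)) * (4 * (1 - ρ) - 7 / 8 * ρ - (7 / 10 - ρ)) :=
        mul_nonneg hWpos.le (by linarith)
      -- Too many marks favour `low`, too few favour `high`; either contributes at least `64 / 16 =
      -- 4` times the common weight.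
      rcases dist_of_odd hodd hM h0 h1 with hd | hd
      · have h3 := mul_le_mul_of_nonneg_left (key _ hd) hWβ
        linarith
      · have h3 := mul_le_mul_of_nonneg_left (key _ hd) hWβ
        linarith
    · have ha := B.complete_run .acc he' (Or.inr ⟨Or.inr hodd, rfl⟩)
      rw [prod_weight_acc] at ha
      have : 0 ≤ (1 / 512 : ℝ) ^ (8 ^ (n + 1)) * (7 / 8 * (1 - ρ) - (7 / 10 - ρ)) :=
        mul_nonneg hWpos.le (by linarith)
      linarith

end UnaryVerifier

/-! ### The theorem -/

namespace UnaryVerifier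

open PTMVerifier

/-- A family of nonnegative numbers is bounded below by `c` if every smaller lower bound can be
improved by a fixed fraction of the missing amount. -/
theorem le_of_forall_improve {ι : Type*} {X : ι → ℝ} {c δ : ℝ} (hX : ∀ h, 0 ≤ X h) (hδ : 0 < δ)
    (himp : ∀ ρ, 0 ≤ ρ → ρ ≤ c → (∀ h, ρ ≤ X h) → ∀ h, δ * (c - ρ) ≤ X h - ρ) (h : ι) :
    c ≤ X h := by
  by_contra hlt
  push Not at hlt
  have : Nonempty ι := ⟨h⟩
  have hbdd : BddBelow (Set.range X) := ⟨0, by rintro _ ⟨h, rfl⟩; exact hX h⟩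
  have hle : ∀ h, ⨅ h, X h ≤ X h := fun h => ciInf_le hbdd h
  have hc : ⨅ h, X h < c := (hle h).trans_lt hlt
  have h1 := himp _ (le_ciInf hX) hc.le hle
  have h2 : (⨅ h, X h) + δ * (c - ⨅ h, X h) ≤ ⨅ h, X h :=
    le_ciInf fun h => by linarith [h1 h]
  have h3 := mul_pos hδ (sub_pos.2 hc)
  linarith

/-- The symbols of the honest prover for inputs of length `n`, with `m` marked rows. -/
def honestSymbol (n m t : ℕ) : Bool × Bool :=
  (decide (8 ^ (t % (2 * (n + 1))) ∣ t / (2 * (n + 1)) + 1), decide (t / (2 * (n + 1)) < m))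

/-- The honest prover: it counts the requests of the current round. -/
def honestProver (θ : ℝ) (m : ℕ → ℕ) : (verifier θ).Prover := fun w l =>
  -- The list already contains the current request, hence `- 1`; `fresh` stops the count at the
  -- start of the round.
  honestSymbol w.length (m w.length) ((List.takeWhile (· = cont) l).length - 1)

theorem stream_honestProver (θ : ℝ) (m : ℕ → ℕ) (w : List Unit) {h : List (Bool × Bool)}
    (hh : h = [] ∨ ∃ l, h = fresh :: l) (t : ℕ) :
    stream (honestProver θ m) w h t = honestSymbol w.length (m w.length) t := by
  have h1 : h.takeWhile (· = cont) = [] := by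
    rcases hh with rfl | ⟨l, rfl⟩ <;> simp [fresh, cont]
  have h2 : (List.replicate (t + 1) cont ++ h).takeWhile (· = cont) =
      List.replicate (t + 1) cont := by
    rw [List.takeWhile_append_of_pos (by simp), h1, List.append_nil]
  simp only [stream, honestProver, sentAt]
  rw [h2]
  simp

theorem entry_honest {s : ℕ → Bool × Bool} {n m : ℕ} (hs : ∀ t, s t = honestSymbol n m t)
    (i k : ℕ) (hk : k ≤ n + 1) : entry s n i k = decide (8 ^ k ∣ i + 1) := by
  have hlt : k < 2 * (n + 1) := by omega
  simp only [entry, hs, honestSymbol, Nat.mul_add_mod_self_right, Nat.mod_eq_of_lt hlt]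
  rw [Nat.mul_comm i, Nat.mul_add_div (by omega), Nat.div_eq_of_lt hlt, add_zero]

theorem markCount_honest {s : ℕ → Bool × Bool} {n m : ℕ} (hs : ∀ t, s t = honestSymbol n m t)
    (i : ℕ) : markCount (mark s n) i = min i m := by
  induction i with
  | zero => simp [markCount]
  | succ i ih =>
    have : mark s n i = decide (i < m) := by
      simp only [mark, hs, honestSymbol]
      rw [Nat.mul_div_cancel _ (by omega)]
    rw [markCount, ih, this]
    by_cases hi : i < m <;> simp [hi] <;> omega

theorem ofReal_le_value {θ r : ℝ} {w : List Unit} {P : (verifier θ).Prover} {q : State}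
    (hq : q = VState.accept ∨ q = VState.reject)
    (h : r ≤ val θ w P q (.reading .choose) 0 []) :
    ENNReal.ofReal r ≤ (verifier θ).value w P q (verifier θ).initialConfig :=
  ENNReal.ofReal_le_of_le_toReal (h.trans (val_home hq 0 []))

end UnaryVerifier

open UnaryVerifier PTMVerifier in
/-- Every unary language (a language over a one-letter alphabet) has an interactive proof system
with bounded error whose verifier is a logarithmic-space probabilistic Turing machine. -/
theorem theorem2 (L : Language Unit) :
    ∃ (V : PTMVerifier Unit) (ε : ℝ), 0 ≤ ε ∧ ε < 1 / 2 ∧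
      V.Verifies L ε ∧ V.SpaceBounded (fun n => Nat.log 2 n) := by
  obtain ⟨θ, hθ0, hθ1, hθ⟩ := exists_real_encoding fun n => List.replicate n () ∈ L
  choose m hmle hmodd hm0 hm1 using hθ
  have hmem : ∀ w : List Unit, Odd (m w.length) ↔ w ∈ L := fun w => by
    rw [hmodd, ← List.eq_replicate_length.2 fun _ _ => rfl]
  refine ⟨verifier θ, 3 / 10, by norm_num, by norm_num, ⟨⟨honestProver θ m, fun w hw => ?_⟩,
    fun w hw P => ?_⟩, spaceBounded θ _⟩
  · rw [acceptProb_eq_value]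
    refine ofReal_le_value (Or.inl rfl) ?_
    -- Only histories at the start of a round are admitted: elsewhere the honest prover's count
    -- would be out of phase. Restarts stay within this family.
    let X : {h : List (Bool × Bool) // h = [] ∨ ∃ l, h = fresh :: l} → ℝ := fun h =>
      val θ w (honestProver θ m) .accept (.reading .choose) 0 h
    refine le_trans (by norm_num) (le_of_forall_improve (X := X) (c := 7 / 10)
      (δ := (1 / 2) ^ (w.length + 1) * (1 / 512) ^ (8 ^ (w.length + 1)))
      (fun h => val_nonneg ..) (by positivity) (fun ρ hρ0 hρ1 hρ h => ?_) ⟨[], Or.inl rfl⟩)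
    have hs := stream_honestProver θ m w h.2
    have hcount : markCount (mark (stream (honestProver θ m) w h) w.length)
        (8 ^ (w.length + 1)) = m w.length := by
      rw [markCount_honest hs, min_eq_right (hmle _)]
    refine completeness_bound (roundBounds hθ0 hθ1 (Or.inl rfl) (by linarith)
      (fun l => hρ ⟨fresh :: l, Or.inr ⟨l, rfl⟩⟩) (fun p l => ?_) (fun p l => ?_) h)
      hρ0 hρ1 (entry_honest hs) ?_ ?_ ?_
    · rw [val_halted (Or.inl rfl)]
    · rw [neg_le_sub_iff_le_add]
      linarith [val_nonneg (θ := θ) (w := w) (P := honestProver θ m) (q := .accept) .reject p l]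
    · rw [hcount]; exact (hmem w).2 hw
    · rw [hcount]; exact hm0 _
    · rw [hcount]; exact hm1 _
  · rw [rejectProb_eq_value]
    refine ofReal_le_value (Or.inr rfl) ?_
    refine le_trans (by norm_num) (le_of_forall_improve
      (X := fun h => val θ w P .reject (.reading .choose) 0 h) (c := 7 / 10)
      (δ := (1 / 2) ^ (w.length + 1) * (1 / 512) ^ (8 ^ (w.length + 1)))
      (fun h => val_nonneg ..) (by positivity) (fun ρ hρ0 hρ1 hρ h => ?_) [])
    refine soundness_bound (roundBounds hθ0 hθ1 (Or.inr rfl) (by linarith)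
      (fun l => hρ (fresh :: l)) (fun p l => ?_) (fun p l => ?_) h) hθ0 hθ1
      hρ0 hρ1 (M := m w.length) (fun ho => hw ((hmem w).1 ho)) (hm0 _) (hm1 _)
    · linarith [val_nonneg (θ := θ) (w := w) (P := P) (q := .reject) .accept p l]
    · rw [val_halted (Or.inr rfl)]
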